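/- Let $\mathbb{R}^{3,3}$ be a real $6$-dimensional space with inner product of signature $(3,3)$; call a vector $v$ positive if $v\cdot v>0$, negative if $v\cdot v<0$, and a unit vector if $|v\cdot v|=1$. Let $\mathcal{CL}(3,3)$ be its Clifford algebra (with $v^2=v\cdot v$), with its usual topology as a finite-dimensional real vector space, and let $Spin(3,3)\subset\mathcal{CL}(3,3)$ be the set of Clifford products of an even number of unit vectors, with the subspace topology. Then $Spin(3,3)$ has exactly two connected components: $Spin_0(3,3)$, the one containing the identity, and the other one, $Spin_1(3,3)$. An element of $\mathcal{CL}(3,3)$ lies in $Spin_0(3,3)$ if and only if it is a Clifford product of unit vectors (in any order) of which an even number are positive and an even number are negative; it lies in $Spin_1(3,3)$ if and only if it is a Clifford product of unit vectors (in any order) of which an odd number are positive and an odd number are negative. In particular $\pm1\in Spin_0(3,3)$. Moreover, let $E_1,E_2,E_3,E_1',E_2',E_3'$ be any Witt basis of $\mathbb{R}^{3,3}$, i.e. $E_i\cdot E_j=E_i'\cdot E_j'=0$ and $E_i\cdot E_j'=\delta_{ij}$ for all $i,j$, and put $I_{3,3}:=E_1\wedge E_2\wedge E_3\wedge E_1'\wedge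 E_2'\wedge E_3'$, an element of $\Lambda^6(\mathbb{R}^{3,3})$ regarded as an element of $\mathcal{CL}(3,3)$ under the canonical identification of $\Lambda(\mathbb{R}^{3,3})$ with $\mathcal{CL}(3,3)$. Then $\pm I_{3,3}\in Spin_1(3,3)$ and $I_{3,3}^2=1$. -/

import Mathlib

noncomputable section

namespace SplitSpin

variable {V : Type*} [AddCommGroup V] [Module ℝ V]

/-- The quadratic space `(V, Q)`, with `Q v = v · v`, has signature `ℝ^{p,q} = ℝ^{p,q,0}`: it has a
basis in which the metric is diagonal, with `p` entries `1` and `q` entries `-1`. -/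
def HasSignature (Q : QuadraticForm ℝ V) (p q : ℕ) : Prop :=
  ∃ b : Module.Basis (Fin p ⊕ Fin q) ℝ V,
    (∀ i j, i ≠ j → QuadraticMap.associated (R := ℝ) Q (b i) (b j) = 0) ∧
    (∀ i, Q (b (Sum.inl i)) = 1) ∧ (∀ j, Q (b (Sum.inr j)) = -1)

/-- `E 0, E 1, E 2` and `E' 0, E' 1, E' 2` form a Witt basis: they span null spaces and
`E i · E' j = δ i j`. Here `x · y` is the symmetric bilinear form with `x · x = Q x`. Linear
independence follows from these relations, so that in dimension 6 this is a basis of `V`. -/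
structure IsWittBasis (Q : QuadraticForm ℝ V) (E E' : Fin 3 → V) : Prop where
  null_left : ∀ i j, QuadraticMap.associated (R := ℝ) Q (E i) (E j) = 0
  null_right : ∀ i j, QuadraticMap.associated (R := ℝ) Q (E' i) (E' j) = 0
  dual : ∀ i j, QuadraticMap.associated (R := ℝ) Q (E i) (E' j) = if i = j then 1 else 0

/-- The canonical topology of the real vector space `CL(V, Q)`: the finest topology that makes
addition and scalar multiplication continuous. For finite-dimensional `V` it is the usual topology of a
finite-dimensional real vector space. -/
instance instTopologicalSpace (Q : QuadraticForm ℝ V) : TopologicalSpace (CliffordAlgebra Q) :=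
  moduleTopology ℝ (CliffordAlgebra Q)

instance instIsModuleTopology (Q : QuadraticForm ℝ V) :
    IsModuleTopology ℝ (CliffordAlgebra Q) := ⟨rfl⟩

/-- The Clifford product of the vectors of a list, in the order of the list. -/
def cliffordProd (Q : QuadraticForm ℝ V) (l : List V) : CliffordAlgebra Q :=
  (l.map (CliffordAlgebra.ι Q)).prod

/-- `v` is an (invertible) vector of unit magnitude: `v · v = 1` or `v · v = -1`. -/
def IsUnitVector (Q : QuadraticForm ℝ V) (v : V) : Prop := |Q v| = 1

/-- The number of positive vectors (`v · v > 0`) in a list. -/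
def numPos (Q : QuadraticForm ℝ V) (l : List V) : ℕ := l.countP (fun v => decide (0 < Q v))

/-- The number of negative vectors (`v · v < 0`) in a list. -/
def numNeg (Q : QuadraticForm ℝ V) (l : List V) : ℕ := l.countP (fun v => decide (Q v < 0))

/-- `Spin(V, Q)`: the Clifford products of an even number of unit vectors, positive or negative. -/
def Spin (Q : QuadraticForm ℝ V) : Set (CliffordAlgebra Q) :=
  {x | ∃ l : List V, (∀ v ∈ l, IsUnitVector Q v) ∧ Even l.length ∧ x = cliffordProd Q l}

/-- `Spin_0`: the connected component of `Spin` that contains the identity. -/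
def Spin₀ (Q : QuadraticForm ℝ V) : Set (CliffordAlgebra Q) := connectedComponentIn (Spin Q) 1

/-- `Spin_1`: the rest of `Spin`, which is the other connected component when `Spin` has exactly
two of them. -/
def Spin₁ (Q : QuadraticForm ℝ V) : Set (CliffordAlgebra Q) := Spin Q \ Spin₀ Q

/-- The outer product `E 0 ∧ E 1 ∧ E 2 ∧ E' 0 ∧ E' 1 ∧ E' 2`, as an element of the Clifford algebra,
under the canonical linear identification of `Λ(V)` with `CL(V, Q)`. -/
def pseudoscalar (Q : QuadraticForm ℝ V) (E E' : Fin 3 → V) : CliffordAlgebra Q :=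
  (CliffordAlgebra.equivExterior Q).symm
    (ExteriorAlgebra.ιMulti ℝ 6 ![E 0, E 1, E 2, E' 0, E' 1, E' 2])

end SplitSpin

end

noncomputable section

namespace SplitSpin

open CliffordAlgebra Pointwise

variable {V : Type*} [AddCommGroup V] [Module ℝ V] {Q : QuadraticForm ℝ V}

/-! An even product of unit vectors has either evenly many or oddly many factors of each sign, so
`Spin` is the union of two parity classes. They are told apart by a continuous function: `x *
reverse x` telescopes to the product of the squares of the factors, so `spinorNorm` equals `(-1) ^
numNeg`, namely 1 on the even class and -1 on the odd one. The classes are therefore disjoint, and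
no connected subset of `Spin` meets both.

Each class is connected. For `p, q ≥ 2` the vectors of square 1 form a connected hyperboloid, and so
do those of square -1, so every factor can be moved independently to one of two fixed orthogonal
vectors `e`, `f` with squares 1 and -1. The product becomes `±1` in the even class and `±ef` in the
odd one, and the sign disappears on replacing a factor `u` by `-u`, which has the same square. Hence
`connectedComponentIn_union_eq` identifies both components.

For a Witt basis, the vectors `E i ± E' i / 2` are orthonormal, three positive and three negative,
and their Clifford product is the pseudoscalar. This puts it in the odd class, and its square is a
computation of signs. -/

theorem HasSignature.moduleFinite {p q : ℕ} (hQ : HasSignature Q p q) : Module.Finite ℝ V :=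
  let ⟨b, _⟩ := hQ
  Module.Finite.of_basis b

instance instFiniteCliffordAlgebra [Module.Finite ℝ V] : Module.Finite ℝ (CliffordAlgebra Q) :=
  have : Module.Finite ℝ (ExteriorAlgebra ℝ V) :=
    Module.Finite.of_basis (Module.finBasis ℝ V).ExteriorAlgebra
  Module.Finite.equiv (equivExterior Q).symm

instance instIsTopologicalRing [Module.Finite ℝ V] : IsTopologicalRing (CliffordAlgebra Q) :=
  IsModuleTopology.isTopologicalRing ℝ _

/-! ### Lists of unit vectors -/

theorem cliffordProd_cons (v : V) (l : List V) :
    cliffordProd Q (v :: l) = ι Q v * cliffordProd Q l := by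
  simp [cliffordProd]

theorem IsUnitVector.eq_or_eq {v : V} (hv : IsUnitVector Q v) : Q v = 1 ∨ Q v = -1 :=
  eq_or_eq_neg_of_abs_eq hv

/-- With the two count lemmas below: a parity class sees only the list of squares, so deformations
that fix the squares stay inside it. -/
theorem forall_isUnitVector_congr {l l' : List V} (h : l'.map Q = l.map Q)
    (hl : ∀ v ∈ l, IsUnitVector Q v) : ∀ v ∈ l', IsUnitVector Q v := by
  have key : ∀ l : List V, (∀ v ∈ l, IsUnitVector Q v) ↔ ∀ r ∈ l.map Q, |r| = 1 := by
    simp [IsUnitVector]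
  rw [key] at hl ⊢
  rwa [h]

theorem numPos_congr {l l' : List V} (h : l'.map Q = l.map Q) : numPos Q l' = numPos Q l := by
  have key : ∀ l : List V, numPos Q l = (l.map Q).countP (fun r => decide (0 < r)) := by
    simp [numPos, List.countP_map, Function.comp_def]
  rw [key, key, h]

theorem numNeg_congr {l l' : List V} (h : l'.map Q = l.map Q) : numNeg Q l' = numNeg Q l := by
  have key : ∀ l : List V, numNeg Q l = (l.map Q).countP (fun r => decide (r < 0)) := by
    simp [numNeg, List.countP_map, Function.comp_def]
  rw [key, key, h]

theorem numPos_cons_of_eq_one {v : V} (h : Q v = 1) (l : List V) :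
    numPos Q (v :: l) = numPos Q l + 1 := by
  simp [numPos, h]

theorem numPos_cons_of_eq_neg_one {v : V} (h : Q v = -1) (l : List V) :
    numPos Q (v :: l) = numPos Q l := by
  simp [numPos, h]

theorem numNeg_cons_of_eq_one {v : V} (h : Q v = 1) (l : List V) :
    numNeg Q (v :: l) = numNeg Q l := by
  simp [numNeg, h]

theorem numNeg_cons_of_eq_neg_one {v : V} (h : Q v = -1) (l : List V) :
    numNeg Q (v :: l) = numNeg Q l + 1 := by
  simp [numNeg, h]

@[simp] theorem numPos_nil : numPos Q [] = 0 := rfl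

@[simp] theorem numNeg_nil : numNeg Q [] = 0 := rfl

theorem length_eq_numPos_add_numNeg {l : List V} (hl : ∀ v ∈ l, IsUnitVector Q v) :
    l.length = numPos Q l + numNeg Q l := by
  induction l with
  | nil => simp
  | cons v l ih =>
    rw [List.forall_mem_cons] at hl
    rcases hl.1.eq_or_eq with h | h
    · rw [numPos_cons_of_eq_one h, numNeg_cons_of_eq_one h, List.length_cons, ih hl.2]
      omega
    · rw [numPos_cons_of_eq_neg_one h, numNeg_cons_of_eq_neg_one h, List.length_cons, ih hl.2]
      omega

/-! ### The spinor norm -/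

/-- The scalar part of `x * reverse x`. -/
def spinorNorm (Q : QuadraticForm ℝ V) (x : CliffordAlgebra Q) : ℝ :=
  ExteriorAlgebra.algebraMapInv (equivExterior Q (x * reverse x))

theorem continuous_spinorNorm [Module.Finite ℝ V] : Continuous (spinorNorm Q) := by
  have h₁ : Continuous (reverse (Q := Q)) := IsModuleTopology.continuous_of_linearMap _
  have h₂ : Continuous (ExteriorAlgebra.algebraMapInv.toLinearMap ∘ₗ
      (equivExterior Q).toLinearMap : CliffordAlgebra Q →ₗ[ℝ] ℝ) :=
    IsModuleTopology.continuous_of_linearMap _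
  exact h₂.comp (continuous_id.mul h₁)

/-- The product telescopes from the inside: each innermost pair `v * v` is a scalar, hence central.
-/
theorem cliffordProd_mul_reverse (l : List V) :
    cliffordProd Q l * reverse (cliffordProd Q l) = algebraMap ℝ _ (l.map Q).prod := by
  induction l with
  | nil => simp [cliffordProd]
  | cons v l ih =>
    rw [cliffordProd_cons, reverse.map_mul, reverse_ι, mul_assoc, ← mul_assoc (cliffordProd Q l),
      ih, Algebra.commutes, ← mul_assoc, ι_sq_scalar, ← map_mul, List.map_cons, List.prod_cons]

theorem prod_map_eq_neg_one_pow {l : List V} (hl : ∀ v ∈ l, IsUnitVector Q v) :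
    (l.map Q).prod = (-1) ^ numNeg Q l := by
  induction l with
  | nil => simp
  | cons v l ih =>
    rw [List.forall_mem_cons] at hl
    rcases hl.1.eq_or_eq with h | h
    · rw [numNeg_cons_of_eq_one h, List.map_cons, List.prod_cons, h, ih hl.2, one_mul]
    · rw [numNeg_cons_of_eq_neg_one h, List.map_cons, List.prod_cons, h, ih hl.2, pow_succ']

theorem spinorNorm_cliffordProd {l : List V} (hl : ∀ v ∈ l, IsUnitVector Q v) :
    spinorNorm Q (cliffordProd Q l) = (-1) ^ numNeg Q l := by
  rw [spinorNorm, cliffordProd_mul_reverse, prod_map_eq_neg_one_pow hl, equivExterior,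
    changeFormEquiv_apply, changeForm_algebraMap]
  exact ExteriorAlgebra.algebraMap_leftInverse V _

/-! ### Connectedness -/

/-- The hyperboloid is the image of (unit sphere) × `F` under `(u, y) ↦ (√(1 + ‖y‖²) u, y)`, and the
sphere is connected in dimension greater than 1. -/
theorem isPreconnected_hyperboloid {E F : Type*} [NormedAddCommGroup E] [NormedSpace ℝ E]
    [NormedAddCommGroup F] [NormedSpace ℝ F] (hE : 1 < Module.rank ℝ E) :
    IsPreconnected {p : E × F | ‖p.1‖ ^ 2 - ‖p.2‖ ^ 2 = 1} := by
  have h := ((isPreconnected_sphere hE 0 1).prod (isPreconnected_univ (α := F))).image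
    (fun p => (√(1 + ‖p.2‖ ^ 2) • p.1, p.2)) (by fun_prop)
  convert h using 1
  ext ⟨x, y⟩
  have hpos : 0 < 1 + ‖y‖ ^ 2 := by positivity
  have hs : √(1 + ‖y‖ ^ 2) ≠ 0 := (Real.sqrt_pos.2 hpos).ne'
  constructor
  · intro hxy
    have hx : √(1 + ‖y‖ ^ 2) = ‖x‖ := by
      rw [Real.sqrt_eq_iff_mul_self_eq hpos.le (norm_nonneg x)]
      have : ‖x‖ ^ 2 - ‖y‖ ^ 2 = 1 := hxy
      linarith
    refine ⟨((√(1 + ‖y‖ ^ 2))⁻¹ • x, y), ⟨?_, trivial⟩, ?_⟩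
    · rw [mem_sphere_zero_iff_norm, norm_smul, norm_inv, Real.norm_eq_abs, abs_of_nonneg
        (Real.sqrt_nonneg _), ← hx, inv_mul_cancel₀ hs]
    · simp [smul_smul, mul_inv_cancel₀ hs]
  · rintro ⟨⟨u, w⟩, ⟨hu, -⟩, h⟩
    simp only [Prod.mk.injEq] at h
    obtain ⟨rfl, rfl⟩ := h
    rw [mem_sphere_zero_iff_norm] at hu
    simp only at hu
    simp [norm_smul, hu, Real.sq_sqrt hpos.le]

theorem HasSignature.exists_linearEquiv {p q : ℕ} (hQ : HasSignature Q p q) :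
    ∃ T : (EuclideanSpace ℝ (Fin p) × EuclideanSpace ℝ (Fin q)) ≃ₗ[ℝ] V,
      ∀ x, Q (T x) = ‖x.1‖ ^ 2 - ‖x.2‖ ^ 2 := by
  obtain ⟨b, hb, hp, hn⟩ := hQ
  refine ⟨((WithLp.linearEquiv 2 ℝ _).prodCongr (WithLp.linearEquiv 2 ℝ _)) ≪≫ₗ
    (LinearEquiv.sumArrowLequivProdArrow (Fin p) (Fin q) ℝ ℝ).symm ≪≫ₗ b.equivFun.symm, ?_⟩
  intro x
  have h := QuadraticMap.basisRepr_eq_of_iIsOrtho Q b (fun i j hij => hb i j hij)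
  have h' := DFunLike.congr_fun h ((LinearEquiv.sumArrowLequivProdArrow (Fin p) (Fin q) ℝ ℝ).symm
    (WithLp.ofLp x.1, WithLp.ofLp x.2))
  rw [QuadraticMap.basisRepr_apply, QuadraticMap.weightedSumSquares_apply] at h'
  simp only [LinearEquiv.trans_apply, Module.Basis.equivFun_symm_apply]
  refine h'.trans ?_
  rw [EuclideanSpace.real_norm_sq_eq, EuclideanSpace.real_norm_sq_eq]
  simp [hp, hn, sq, sub_eq_add_neg]

theorem HasSignature.isPreconnected_image_ι {p q : ℕ} (hQ : HasSignature Q p q) (hp : 1 < p)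
    (hq : 1 < q) {r : ℝ} (hr : |r| = 1) : IsPreconnected (ι Q '' {v | Q v = r}) := by
  have hrank : ∀ n : ℕ, 1 < n → 1 < Module.rank ℝ (EuclideanSpace ℝ (Fin n)) := by
    intro n hn
    rw [rank_eq_card_basis (EuclideanSpace.basisFun (Fin n) ℝ).toBasis]
    simpa using hn
  have := hQ.moduleFinite
  obtain ⟨T, hT⟩ := hQ.exists_linearEquiv
  have hc : Continuous (ι Q ∘ₗ T.toLinearMap) := LinearMap.continuous_of_finiteDimensional _
  have hset : ι Q '' {v | Q v = r} =
      (ι Q ∘ₗ T.toLinearMap) '' {x | ‖x.1‖ ^ 2 - ‖x.2‖ ^ 2 = r} := by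
    rw [LinearMap.coe_comp, Set.image_comp]
    congr 1
    ext v
    obtain ⟨x, rfl⟩ := T.surjective v
    simp [hT]
  rw [hset]
  refine IsPreconnected.image ?_ _ hc.continuousOn
  rcases eq_or_eq_neg_of_abs_eq hr with rfl | rfl
  · exact isPreconnected_hyperboloid (hrank p hp)
  -- Exchanging the two summands turns square -1 into square 1.
  · convert (isPreconnected_hyperboloid (F := EuclideanSpace ℝ (Fin p)) (hrank q hq)).image
      Prod.swap continuous_swap.continuousOn using 1
    ext x
    simp only [Set.image_swap_eq_preimage_swap, Set.mem_preimage, Set.mem_ofPred_eq, Prod.fst_swap,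
      Prod.snd_swap]
    constructor <;> intro h <;> linarith

theorem isPreconnected_list_prod {M : Type*} [Monoid M] [TopologicalSpace M] [ContinuousMul M]
    {L : List (Set M)} (hL : ∀ s ∈ L, IsPreconnected s) : IsPreconnected L.prod := by
  induction L with
  | nil => exact isPreconnected_singleton
  | cons s L ih =>
    rw [List.forall_mem_cons] at hL
    rw [List.prod_cons, ← Set.image_mul_prod]
    exact (hL.1.prod (ih hL.2)).image _ continuous_mul.continuousOn

/-- The Clifford products of lists of vectors with prescribed squares. -/
def prodsWithSquares (Q : QuadraticForm ℝ V) (L : List ℝ) : Set (CliffordAlgebra Q) :=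
  {x | ∃ l : List V, l.map Q = L ∧ x = cliffordProd Q l}

/-- A pointwise product of sets, so connectedness of the factors passes to it by
`isPreconnected_list_prod`. -/
theorem prodsWithSquares_eq (L : List ℝ) :
    prodsWithSquares Q L = (L.map fun r => ι Q '' {v | Q v = r}).prod := by
  induction L with
  | nil =>
    ext x
    simp [prodsWithSquares, cliffordProd]
  | cons r L ih =>
    rw [List.map_cons, List.prod_cons, ← ih]
    ext x
    constructor
    · rintro ⟨l, hl, rfl⟩
      obtain ⟨v, l, rfl, hv, hl⟩ := List.map_eq_cons_iff.1 hl
      rw [cliffordProd_cons]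
      exact Set.mul_mem_mul ⟨v, hv, rfl⟩ ⟨l, hl, rfl⟩
    · rintro ⟨_, ⟨v, hv, rfl⟩, _, ⟨l, hl, rfl⟩, rfl⟩
      exact ⟨v :: l, by rw [List.map_cons, hl, hv], (cliffordProd_cons v l).symm⟩

theorem HasSignature.isPreconnected_prodsWithSquares {p q : ℕ} (hQ : HasSignature Q p q)
    (hp : 1 < p) (hq : 1 < q) {L : List ℝ} (hL : ∀ r ∈ L, |r| = 1) :
    IsPreconnected (prodsWithSquares Q L) := by
  have := hQ.moduleFinite
  rw [prodsWithSquares_eq]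
  apply isPreconnected_list_prod
  simp only [List.mem_map]
  rintro _ ⟨r, hr, rfl⟩
  exact hQ.isPreconnected_image_ι hp hq (hL r hr)

/-- The Clifford products of unit vectors of which the number of positive ones and the number of
negative ones both satisfy `P`. -/
def parityClass (Q : QuadraticForm ℝ V) (P : ℕ → Prop) : Set (CliffordAlgebra Q) :=
  {x | ∃ l : List V, (∀ v ∈ l, IsUnitVector Q v) ∧ P (numPos Q l) ∧ P (numNeg Q l) ∧
    x = cliffordProd Q l}

theorem neg_cliffordProd_cons (v : V) (l : List V) :
    -cliffordProd Q (v :: l) = cliffordProd Q (-v :: l) := by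
  simp [cliffordProd_cons]

theorem prodsWithSquares_subset_parityClass {P : ℕ → Prop} {l : List V}
    (hl : ∀ v ∈ l, IsUnitVector Q v) (hp : P (numPos Q l)) (hn : P (numNeg Q l)) :
    prodsWithSquares Q (l.map Q) ⊆ parityClass Q P := by
  rintro _ ⟨l', h, rfl⟩
  exact ⟨l', forall_isUnitVector_congr h hl, by rwa [numPos_congr h], by rwa [numNeg_congr h], rfl⟩

/-- A class is connected when each of its products can be deformed, keeping the squares of the
factors, to plus or minus a fixed nonempty product of the class. -/
theorem HasSignature.isPreconnected_parityClass {p q : ℕ} (hQ : HasSignature Q p q)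
    (hp : 1 < p) (hq : 1 < q) {P : ℕ → Prop} {u : V} {k : List V}
    (hk : ∀ v ∈ u :: k, IsUnitVector Q v) (hkp : P (numPos Q (u :: k)))
    (hkn : P (numNeg Q (u :: k)))
    (h : ∀ l : List V, (∀ v ∈ l, IsUnitVector Q v) → P (numPos Q l) → P (numNeg Q l) →
      ∃ l', l'.map Q = l.map Q ∧ (cliffordProd Q l' = cliffordProd Q (u :: k) ∨
        cliffordProd Q l' = -cliffordProd Q (u :: k))) :
    IsPreconnected (parityClass Q P) := by
  have hconn : ∀ l : List V, (∀ v ∈ l, IsUnitVector Q v) →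
      IsPreconnected (prodsWithSquares Q (l.map Q)) := fun l hl =>
    hQ.isPreconnected_prodsWithSquares hp hq (by simpa [IsUnitVector] using hl)
  apply isPreconnected_of_forall (cliffordProd Q (u :: k))
  rintro _ ⟨l, hl, hlp, hln, rfl⟩
  obtain ⟨l', hl', hx⟩ := h l hl hlp hln
  have hmem : cliffordProd Q l' ∈ prodsWithSquares Q ((u :: k).map Q) := by
    rcases hx with hx | hx
    · exact ⟨u :: k, rfl, hx⟩
    -- The sign is absorbed in the first factor, which is why the fixed product must be nonempty.
    · exact ⟨-u :: k, by simp, by rw [hx, neg_cliffordProd_cons]⟩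
  exact ⟨prodsWithSquares Q (l.map Q) ∪ prodsWithSquares Q ((u :: k).map Q),
    Set.union_subset (prodsWithSquares_subset_parityClass hl hlp hln)
      (prodsWithSquares_subset_parityClass hk hkp hkn),
    Or.inr ⟨_, rfl, rfl⟩, Or.inl ⟨_, rfl, rfl⟩,
    (hconn l hl).union _ ⟨l', hl', rfl⟩ hmem (hconn _ hk)⟩

/-- A product of copies of two anticommuting vectors is, up to sign, a product of powers. -/
theorem exists_cliffordProd_eq {e f : V} (he : Q e = 1) (hf : Q f = -1)
    (hef : ι Q f * ι Q e = -(ι Q e * ι Q f)) {l : List V} (hl : ∀ v ∈ l, IsUnitVector Q v) :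
    ∃ l', l'.map Q = l.map Q ∧ ∃ n : ℕ,
      cliffordProd Q l' = (-1) ^ n * (ι Q e ^ numPos Q l * ι Q f ^ numNeg Q l) := by
  have hcomm : ∀ m : ℕ, ι Q f * ι Q e ^ m = (-1) ^ m * (ι Q e ^ m * ι Q f) := by
    intro m
    induction m with
    | zero => simp
    | succ m ih =>
      rw [pow_succ, ← mul_assoc, ih, mul_assoc, mul_assoc, hef]
      simp [pow_succ, mul_assoc]
  have hsign : ∀ (n : ℕ) (x : CliffordAlgebra Q), x * (-1) ^ n = (-1) ^ n * x := fun n x =>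
    ((Commute.neg_one_right x).pow_right n).eq
  induction l with
  | nil => exact ⟨[], rfl, 0, by simp [cliffordProd]⟩
  | cons v l ih =>
    rw [List.forall_mem_cons] at hl
    obtain ⟨l', hl', n, hn⟩ := ih hl.2
    rcases hl.1.eq_or_eq with h | h
    · refine ⟨e :: l', by simp [hl', he, h], n, ?_⟩
      rw [cliffordProd_cons, hn, numPos_cons_of_eq_one h, numNeg_cons_of_eq_one h, ← mul_assoc,
        hsign, pow_succ' (ι Q e)]
      simp only [mul_assoc]
    -- Moving `f` past the power of `e` costs one sign per copy of `e`.
    · refine ⟨f :: l', by simp [hl', hf, h], n + numPos Q l, ?_⟩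
      rw [cliffordProd_cons, hn, numPos_cons_of_eq_neg_one h, numNeg_cons_of_eq_neg_one h,
        ← mul_assoc, hsign, pow_succ' (ι Q f), mul_assoc, ← mul_assoc (ι Q f), hcomm, pow_add]
      simp only [mul_assoc]

theorem HasSignature.exists_orthogonal_pair {p q : ℕ} (hQ : HasSignature Q p q) (hp : 0 < p)
    (hq : 0 < q) :
    ∃ e f : V, Q e = 1 ∧ Q f = -1 ∧ ι Q f * ι Q e = -(ι Q e * ι Q f) := by
  obtain ⟨b, hb, hpos, hneg⟩ := hQ
  refine ⟨b (Sum.inl ⟨0, hp⟩), b (Sum.inr ⟨0, hq⟩), hpos _, hneg _, ?_⟩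
  apply ι_mul_ι_comm_of_isOrtho
  rw [← QuadraticMap.associated_isOrtho (R := ℝ)]
  exact hb _ _ (by simp)

theorem HasSignature.isPreconnected_parityClass_even {p q : ℕ} (hQ : HasSignature Q p q)
    (hp : 1 < p) (hq : 1 < q) : IsPreconnected (parityClass Q Even) := by
  obtain ⟨e, f, he, hf, hef⟩ := hQ.exists_orthogonal_pair (by omega) (by omega)
  refine hQ.isPreconnected_parityClass hp hq (u := e) (k := [e]) (by simp [IsUnitVector, he])
    (by simp [numPos_cons_of_eq_one he]) (by simp [numNeg_cons_of_eq_one he]) ?_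
  intro l hl hlp hln
  obtain ⟨l', hl', n, hn⟩ := exists_cliffordProd_eq he hf hef hl
  obtain ⟨a, ha⟩ := hlp.two_dvd
  obtain ⟨b, hb⟩ := hln.two_dvd
  refine ⟨l', hl', ?_⟩
  -- The base point 1 is written as `e * e` because the empty product has no factor to absorb a
  -- sign.
  have h1 : cliffordProd Q [e, e] = 1 := by simp [cliffordProd, he]
  rw [h1, hn, ha, hb, pow_mul, pow_mul, sq, sq, ι_sq_scalar, ι_sq_scalar, he, hf, map_neg, map_one,
    one_pow, one_mul, ← pow_add]
  exact neg_one_pow_eq_or _ _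

theorem HasSignature.isPreconnected_parityClass_odd {p q : ℕ} (hQ : HasSignature Q p q)
    (hp : 1 < p) (hq : 1 < q) : IsPreconnected (parityClass Q Odd) := by
  obtain ⟨e, f, he, hf, hef⟩ := hQ.exists_orthogonal_pair (by omega) (by omega)
  refine hQ.isPreconnected_parityClass hp hq (u := e) (k := [f]) (by simp [IsUnitVector, he, hf])
    (by simp [numPos_cons_of_eq_one he, numPos_cons_of_eq_neg_one hf])
    (by simp [numNeg_cons_of_eq_one he, numNeg_cons_of_eq_neg_one hf]) ?_
  intro l hl hlp hln
  obtain ⟨l', hl', n, hn⟩ := exists_cliffordProd_eq he hf hef hl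
  obtain ⟨a, ha⟩ := hlp
  obtain ⟨b, hb⟩ := hln
  refine ⟨l', hl', ?_⟩
  have h1 : cliffordProd Q [e, f] = ι Q e * ι Q f := by simp [cliffordProd]
  have h2 : cliffordProd Q l' = (-1) ^ (n + b) * (ι Q e * ι Q f) := by
    rw [hn, ha, hb, pow_succ, pow_succ, pow_mul, pow_mul, sq, sq, ι_sq_scalar, ι_sq_scalar, he, hf,
      map_neg, map_one, one_pow, one_mul, pow_add, ← mul_assoc (ι Q e),
      ((Commute.neg_one_right (ι Q e)).pow_right b).eq]
    simp only [mul_assoc]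
  rw [h1, h2]
  rcases neg_one_pow_eq_or (CliffordAlgebra Q) (n + b) with h | h <;> simp [h]

/-! ### The components of `Spin` -/

theorem spin_eq_union : Spin Q = parityClass Q Even ∪ parityClass Q Odd := by
  ext x
  constructor
  · rintro ⟨l, hl, hlen, rfl⟩
    rw [length_eq_numPos_add_numNeg hl, Nat.even_add] at hlen
    rcases Nat.even_or_odd (numPos Q l) with h | h
    · exact Or.inl ⟨l, hl, h, hlen.1 h, rfl⟩
    · refine Or.inr ⟨l, hl, h, ?_, rfl⟩
      rw [← Nat.not_even_iff_odd] at h ⊢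
      rwa [← hlen]
  · rintro (⟨l, hl, hp, hn, rfl⟩ | ⟨l, hl, hp, hn, rfl⟩)
    · exact ⟨l, hl, by rw [length_eq_numPos_add_numNeg hl]; exact hp.add hn, rfl⟩
    · exact ⟨l, hl, by rw [length_eq_numPos_add_numNeg hl]; exact hp.add_odd hn, rfl⟩

theorem spinorNorm_of_mem_even {x : CliffordAlgebra Q} (hx : x ∈ parityClass Q Even) :
    spinorNorm Q x = 1 := by
  obtain ⟨l, hl, -, hn, rfl⟩ := hx
  rw [spinorNorm_cliffordProd hl, hn.neg_one_pow]

theorem spinorNorm_of_mem_odd {x : CliffordAlgebra Q} (hx : x ∈ parityClass Q Odd) :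
    spinorNorm Q x = -1 := by
  obtain ⟨l, hl, -, hn, rfl⟩ := hx
  rw [spinorNorm_cliffordProd hl, hn.neg_one_pow]

theorem disjoint_parityClass : Disjoint (parityClass Q Even) (parityClass Q Odd) := by
  rw [Set.disjoint_left]
  intro x h h'
  have := (spinorNorm_of_mem_even h).symm.trans (spinorNorm_of_mem_odd h')
  norm_num at this

/-- Two connected sets that are separated by a continuous function with finitely many values are
the components of their union. -/
theorem connectedComponentIn_union_eq {X : Type*} [TopologicalSpace X] {f : X → ℝ}
    (hf : Continuous f) {A B : Set X} (hA : IsPreconnected A) {a b : ℝ} (hab : a ≠ b)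
    (hfA : ∀ x ∈ A, f x = a) (hfB : ∀ x ∈ B, f x = b) {x : X} (hx : x ∈ A) :
    connectedComponentIn (A ∪ B) x = A := by
  apply Set.Subset.antisymm _ (hA.subset_connectedComponentIn hx Set.subset_union_left)
  intro y hy
  have hmaps : Set.MapsTo f (connectedComponentIn (A ∪ B) x) {a, b} := by
    intro z hz
    rcases connectedComponentIn_subset _ _ hz with h | h
    · exact Or.inl (hfA z h)
    · exact Or.inr (hfB z h)
  have hxy : f y = f x := isPreconnected_connectedComponentIn.constant_of_mapsTo
    (Set.toFinite {a, b}).isDiscrete hf.continuousOn hmaps hy (mem_connectedComponentIn (Or.inl hx))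
  rcases connectedComponentIn_subset _ _ hy with h | h
  · exact h
  · exact absurd ((hfA x hx).symm.trans (hxy.symm.trans (hfB y h))) hab

theorem one_mem_parityClass_even : (1 : CliffordAlgebra Q) ∈ parityClass Q Even :=
  ⟨[], by simp, by simp, by simp, by simp [cliffordProd]⟩

theorem neg_one_mem_parityClass_even {e : V} (he : Q e = 1) :
    (-1 : CliffordAlgebra Q) ∈ parityClass Q Even := by
  have he' : Q (-e) = 1 := by simpa using he
  exact ⟨[-e, e], by simp [IsUnitVector, he],
    by simp [numPos_cons_of_eq_one he, numPos_cons_of_eq_one he'],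
    by simp [numNeg_cons_of_eq_one he, numNeg_cons_of_eq_one he'], by simp [cliffordProd, he]⟩

theorem HasSignature.connectedComponentIn_of_mem_even {p q : ℕ} (hQ : HasSignature Q p q)
    (hp : 1 < p) (hq : 1 < q) {x : CliffordAlgebra Q} (hx : x ∈ parityClass Q Even) :
    connectedComponentIn (Spin Q) x = parityClass Q Even := by
  have := hQ.moduleFinite
  rw [spin_eq_union]
  exact connectedComponentIn_union_eq continuous_spinorNorm
    (hQ.isPreconnected_parityClass_even hp hq) (by norm_num : (1 : ℝ) ≠ -1)
    (fun _ => spinorNorm_of_mem_even) (fun _ => spinorNorm_of_mem_odd) hx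

theorem HasSignature.connectedComponentIn_of_mem_odd {p q : ℕ} (hQ : HasSignature Q p q)
    (hp : 1 < p) (hq : 1 < q) {x : CliffordAlgebra Q} (hx : x ∈ parityClass Q Odd) :
    connectedComponentIn (Spin Q) x = parityClass Q Odd := by
  have := hQ.moduleFinite
  rw [spin_eq_union, Set.union_comm]
  exact connectedComponentIn_union_eq continuous_spinorNorm
    (hQ.isPreconnected_parityClass_odd hp hq) (by norm_num : (-1 : ℝ) ≠ 1)
    (fun _ => spinorNorm_of_mem_odd) (fun _ => spinorNorm_of_mem_even) hx

theorem HasSignature.spin₀_eq {p q : ℕ} (hQ : HasSignature Q p q) (hp : 1 < p) (hq : 1 < q) :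
    Spin₀ Q = parityClass Q Even :=
  hQ.connectedComponentIn_of_mem_even hp hq one_mem_parityClass_even

theorem HasSignature.spin₁_eq {p q : ℕ} (hQ : HasSignature Q p q) (hp : 1 < p) (hq : 1 < q) :
    Spin₁ Q = parityClass Q Odd := by
  rw [Spin₁, hQ.spin₀_eq hp hq, spin_eq_union, Set.union_sdiff_left,
    disjoint_parityClass.symm.sdiff_eq_left]

theorem HasSignature.components_eq {p q : ℕ} (hQ : HasSignature Q p q) (hp : 1 < p) (hq : 1 < q) :
    {C | ∃ x ∈ Spin Q, C = connectedComponentIn (Spin Q) x} = {Spin₀ Q, Spin₁ Q} := by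
  rw [hQ.spin₀_eq hp hq, hQ.spin₁_eq hp hq]
  ext C
  constructor
  · rintro ⟨x, hx, rfl⟩
    rw [spin_eq_union] at hx
    rcases hx with hx | hx
    · exact Or.inl (hQ.connectedComponentIn_of_mem_even hp hq hx)
    · exact Or.inr (hQ.connectedComponentIn_of_mem_odd hp hq hx)
  · rintro (rfl | rfl)
    · exact ⟨1, by rw [spin_eq_union]; exact Or.inl one_mem_parityClass_even,
        (hQ.connectedComponentIn_of_mem_even hp hq one_mem_parityClass_even).symm⟩
    · obtain ⟨e, f, he, hf, -⟩ := hQ.exists_orthogonal_pair (by omega) (by omega)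
      have hmem : cliffordProd Q [e, f] ∈ parityClass Q Odd :=
        ⟨[e, f], by simp [IsUnitVector, he, hf],
          by simp [numPos_cons_of_eq_one he, numPos_cons_of_eq_neg_one hf],
          by simp [numNeg_cons_of_eq_one he, numNeg_cons_of_eq_neg_one hf], rfl⟩
      exact ⟨_, by rw [spin_eq_union]; exact Or.inr hmem,
        (hQ.connectedComponentIn_of_mem_odd hp hq hmem).symm⟩

/-! ### The pseudoscalar -/

theorem contractLeft_cliffordProd_eq_zero (d : Module.Dual ℝ V) {l : List V} (h : ∀ v ∈ l, d v = 0) :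
    contractLeft d (cliffordProd Q l) = 0 := by
  induction l with
  | nil => simp [cliffordProd]
  | cons v l ih =>
    rw [List.forall_mem_cons] at h
    rw [cliffordProd_cons, contractLeft_ι_mul, h.1, ih h.2]
    simp

/-- The canonical identification with the exterior algebra takes the Clifford product of orthogonal
vectors to their outer product. -/
theorem equivExterior_cliffordProd {l : List V}
    (h : l.Pairwise fun v w => QuadraticMap.associated (R := ℝ) Q v w = 0) :
    equivExterior Q (cliffordProd Q l) = (l.map (ExteriorAlgebra.ι ℝ)).prod := by
  induction l with
  | nil => simp [cliffordProd]
  | cons v l ih =>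
    rw [List.pairwise_cons] at h
    have ih' := ih h.2
    rw [equivExterior, changeFormEquiv_apply] at ih' ⊢
    rw [cliffordProd_cons, changeForm_ι_mul, ih', List.map_cons, List.prod_cons]
    have h0 : contractLeft (QuadraticMap.associated (R := ℝ) (-Q) v)
        (cliffordProd (0 : QuadraticForm ℝ V) l) = 0 :=
      -- The correction term contracts by `v` a product of vectors orthogonal to `v`.
      contractLeft_cliffordProd_eq_zero _ fun w hw => by simp [h.1 w hw]
    rw [show (l.map (ExteriorAlgebra.ι ℝ)).prod = cliffordProd (0 : QuadraticForm ℝ V) l from rfl,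
      h0, sub_zero]

/-- The orthonormal basis attached to a Witt basis. -/
def wittOrthonormal (E E' : Fin 3 → V) : List V :=
  [E 0 + (1 / 2 : ℝ) • E' 0, E 0 - (1 / 2 : ℝ) • E' 0, E 1 + (1 / 2 : ℝ) • E' 1,
    E 1 - (1 / 2 : ℝ) • E' 1, E 2 + (1 / 2 : ℝ) • E' 2, E 2 - (1 / 2 : ℝ) • E' 2]

theorem IsWittBasis.dual' {E E' : Fin 3 → V} (h : IsWittBasis Q E E') (i j : Fin 3) :
    QuadraticMap.associated (R := ℝ) Q (E' i) (E j) = if i = j then 1 else 0 := by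
  rw [QuadraticMap.associated_isSymm ℝ Q]
  simp only [h.dual, eq_comm]

theorem IsWittBasis.pairwise_wittOrthonormal {E E' : Fin 3 → V} (h : IsWittBasis Q E E') :
    (wittOrthonormal E E').Pairwise fun v w => QuadraticMap.associated (R := ℝ) Q v w = 0 := by
  simp only [wittOrthonormal, List.pairwise_cons, List.forall_mem_cons, map_add, map_sub, map_smul,
    LinearMap.add_apply, LinearMap.sub_apply, LinearMap.smul_apply, h.null_left, h.null_right,
    h.dual, h.dual']
  simp

theorem IsWittBasis.apply_add {E E' : Fin 3 → V} (h : IsWittBasis Q E E') (i : Fin 3) :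
    Q (E i + (1 / 2 : ℝ) • E' i) = 1 := by
  rw [← QuadraticMap.associated_eq_self_apply ℝ Q]
  simp only [map_add, map_smul, LinearMap.add_apply, LinearMap.smul_apply, h.null_left,
    h.null_right, h.dual, h.dual']
  norm_num

theorem IsWittBasis.apply_sub {E E' : Fin 3 → V} (h : IsWittBasis Q E E') (i : Fin 3) :
    Q (E i - (1 / 2 : ℝ) • E' i) = -1 := by
  rw [← QuadraticMap.associated_eq_self_apply ℝ Q]
  simp only [map_sub, map_smul, LinearMap.sub_apply, LinearMap.smul_apply, h.null_left,
    h.null_right, h.dual, h.dual']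
  norm_num

/-- Each pair gives `(x + y/2) ∧ (x - y/2) = -(x ∧ y)`, hence three signs. Sorting `E 0, E' 0, E 1,
E' 1, E 2, E' 2` takes three transpositions, which cancel them. -/
theorem prod_map_ι_wittOrthonormal (E E' : Fin 3 → V) :
    ((wittOrthonormal E E').map (ExteriorAlgebra.ι ℝ)).prod =
      ExteriorAlgebra.ιMulti ℝ 6 ![E 0, E 1, E 2, E' 0, E' 1, E' 2] := by
  have hswap : ∀ x y : V, ExteriorAlgebra.ι ℝ x * ExteriorAlgebra.ι ℝ y =
      -(ExteriorAlgebra.ι ℝ y * ExteriorAlgebra.ι ℝ x) := fun x y =>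
    eq_neg_of_add_eq_zero_left (ExteriorAlgebra.ι_add_mul_swap x y)
  have hpair : ∀ (x y : V) (z : ExteriorAlgebra ℝ V),
      ExteriorAlgebra.ι ℝ (x + (1 / 2 : ℝ) • y) * (ExteriorAlgebra.ι ℝ (x - (1 / 2 : ℝ) • y) * z) =
        -(ExteriorAlgebra.ι ℝ x * (ExteriorAlgebra.ι ℝ y * z)) := by
    intro x y z
    have : ExteriorAlgebra.ι ℝ (x + (1 / 2 : ℝ) • y) * ExteriorAlgebra.ι ℝ (x - (1 / 2 : ℝ) • y) =
        -(ExteriorAlgebra.ι ℝ x * ExteriorAlgebra.ι ℝ y) := by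
      simp only [map_add, map_sub, map_smul, add_mul, mul_sub, ExteriorAlgebra.ι_sq_zero,
        smul_mul_assoc, mul_smul_comm, hswap y x]
      module
    rw [← mul_assoc, this, neg_mul, mul_assoc]
  have hswap' : ∀ (x y : V) (z : ExteriorAlgebra ℝ V),
      ExteriorAlgebra.ι ℝ x * (ExteriorAlgebra.ι ℝ y * z) =
        -(ExteriorAlgebra.ι ℝ y * (ExteriorAlgebra.ι ℝ x * z)) := by
    intro x y z
    rw [← mul_assoc, hswap, neg_mul, mul_assoc]
  rw [ExteriorAlgebra.ιMulti_apply]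
  simp only [wittOrthonormal, List.map_cons, List.map_nil, List.prod_cons, List.prod_nil, hpair]
  simp only [List.ofFn_succ, List.ofFn_zero, List.prod_cons, List.prod_nil]
  change -(_ * (_ * -(_ * (_ * -(_ * (_ * 1)))))) =
    ExteriorAlgebra.ι ℝ (E 0) * (ExteriorAlgebra.ι ℝ (E 1) * (ExteriorAlgebra.ι ℝ (E 2) *
      (ExteriorAlgebra.ι ℝ (E' 0) * (ExteriorAlgebra.ι ℝ (E' 1) *
        (ExteriorAlgebra.ι ℝ (E' 2) * 1)))))
  rw [hswap' (E 2) (E' 0), mul_neg (ExteriorAlgebra.ι ℝ (E 1)), hswap' (E 1) (E' 0),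
    hswap' (E 2) (E' 1)]
  simp

theorem IsWittBasis.pseudoscalar_eq {E E' : Fin 3 → V} (h : IsWittBasis Q E E') :
    pseudoscalar Q E E' = cliffordProd Q (wittOrthonormal E E') := by
  rw [pseudoscalar, LinearEquiv.symm_apply_eq, equivExterior_cliffordProd
    h.pairwise_wittOrthonormal, prod_map_ι_wittOrthonormal]

theorem cliffordProd_mul_ι_of_orthogonal {v : V} {l : List V}
    (h : ∀ w ∈ l, QuadraticMap.associated (R := ℝ) Q v w = 0) :
    cliffordProd Q l * ι Q v = (-1) ^ l.length * (ι Q v * cliffordProd Q l) := by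
  induction l with
  | nil => simp [cliffordProd]
  | cons w l ih =>
    rw [List.forall_mem_cons] at h
    have hvw : ι Q w * ι Q v = -(ι Q v * ι Q w) := by
      apply ι_mul_ι_comm_of_isOrtho
      apply QuadraticMap.IsOrtho.symm
      rw [← QuadraticMap.associated_isOrtho (R := ℝ)]
      exact h.1
    rw [cliffordProd_cons, mul_assoc, ih h.2, ← mul_assoc,
      ((Commute.neg_one_right (ι Q w)).pow_right _).eq, mul_assoc, ← mul_assoc (ι Q w), hvw,
      List.length_cons, pow_succ]
    simp only [neg_mul, mul_neg, mul_one, mul_assoc]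

/-- Bringing the two copies of each vector together costs one sign per later vector, `0 + 1 + ⋯ + (n
- 1) = n.choose 2` signs in all. -/
theorem cliffordProd_mul_self_of_orthogonal {l : List V}
    (h : l.Pairwise fun v w => QuadraticMap.associated (R := ℝ) Q v w = 0) :
    cliffordProd Q l * cliffordProd Q l =
      (-1) ^ l.length.choose 2 * algebraMap ℝ _ (l.map Q).prod := by
  induction l with
  | nil => simp [cliffordProd]
  | cons v l ih =>
    rw [List.pairwise_cons] at h
    have hsq : ι Q v * ((-1) ^ l.length * (ι Q v * cliffordProd Q l)) * cliffordProd Q l =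
        (-1) ^ l.length * (ι Q v * ι Q v * (cliffordProd Q l * cliffordProd Q l)) := by
      rw [← mul_assoc (ι Q v), ((Commute.neg_one_right (ι Q v)).pow_right _).eq]
      simp only [mul_assoc]
    rw [cliffordProd_cons, mul_assoc, ← mul_assoc (cliffordProd Q l),
      cliffordProd_mul_ι_of_orthogonal h.1, ← mul_assoc, hsq, ih h.2, ι_sq_scalar,
      List.length_cons, Nat.choose_succ_succ' l.length 1, Nat.choose_one_right, pow_add,
      List.map_cons, List.prod_cons, map_mul, ← mul_assoc (algebraMap ℝ (CliffordAlgebra Q) _),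
      Algebra.commutes]
    simp only [mul_assoc]

theorem IsWittBasis.pseudoscalar_mul_self {E E' : Fin 3 → V} (h : IsWittBasis Q E E') :
    pseudoscalar Q E E' * pseudoscalar Q E E' = 1 := by
  rw [h.pseudoscalar_eq, cliffordProd_mul_self_of_orthogonal h.pairwise_wittOrthonormal]
  -- Two signs cancel: `(-1) ^ 15` from reordering and `(-1) ^ 3` from the three negative vectors.
  have hlen : (wittOrthonormal E E').length.choose 2 = 15 := rfl
  have hprod : ((wittOrthonormal E E').map Q).prod = -1 := by
    simp only [wittOrthonormal, List.map_cons, List.map_nil, List.prod_cons, List.prod_nil,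
      h.apply_add, h.apply_sub]
    norm_num
  rw [hlen, hprod, map_neg, map_one, Odd.neg_one_pow (by decide), neg_mul_neg, one_mul]

theorem isUnitVector_of_eq_one {v : V} (h : Q v = 1) : IsUnitVector Q v := by
  simp [IsUnitVector, h]

theorem isUnitVector_of_eq_neg_one {v : V} (h : Q v = -1) : IsUnitVector Q v := by
  simp [IsUnitVector, h]

theorem IsWittBasis.pseudoscalar_mem {E E' : Fin 3 → V} (h : IsWittBasis Q E E') :
    pseudoscalar Q E E' ∈ parityClass Q Odd := by
  refine ⟨wittOrthonormal E E', ?_, ?_, ?_, h.pseudoscalar_eq⟩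
  · simp only [wittOrthonormal, List.forall_mem_cons, isUnitVector_of_eq_one (h.apply_add _),
      isUnitVector_of_eq_neg_one (h.apply_sub _)]
    simp
  · simp only [wittOrthonormal, numPos_cons_of_eq_one (h.apply_add _),
      numPos_cons_of_eq_neg_one (h.apply_sub _), numPos_nil]
    decide
  · simp only [wittOrthonormal, numNeg_cons_of_eq_one (h.apply_add _),
      numNeg_cons_of_eq_neg_one (h.apply_sub _), numNeg_nil]
    decide

theorem neg_mem_parityClass_odd {x : CliffordAlgebra Q} (hx : x ∈ parityClass Q Odd) :
    -x ∈ parityClass Q Odd := by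
  obtain ⟨l, hl, hp, hn, rfl⟩ := hx
  match l with
  -- The empty list has no positive vector, and 0 is not odd.
  | [] => simp at hp
  | v :: l =>
    have hmap : (-v :: l).map Q = (v :: l).map Q := by simp
    exact ⟨-v :: l, forall_isUnitVector_congr hmap hl, by rwa [numPos_congr hmap],
      by rwa [numNeg_congr hmap], neg_cliffordProd_cons v l⟩

end SplitSpin

end

theorem mainTheorem4 {V : Type*} [AddCommGroup V] [Module ℝ V] (Q : QuadraticForm ℝ V)
    (hQ : SplitSpin.HasSignature Q 3 3) :
    -- Spin has exactly two connected components, `Spin₀` and `Spin₁`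
    ({C | ∃ x ∈ SplitSpin.Spin Q, C = connectedComponentIn (SplitSpin.Spin Q) x} =
        {SplitSpin.Spin₀ Q, SplitSpin.Spin₁ Q} ∧
      SplitSpin.Spin₀ Q ≠ SplitSpin.Spin₁ Q) ∧
    (∀ x : CliffordAlgebra Q, x ∈ SplitSpin.Spin₀ Q ↔
      ∃ l : List V, (∀ v ∈ l, SplitSpin.IsUnitVector Q v) ∧
        Even (SplitSpin.numPos Q l) ∧ Even (SplitSpin.numNeg Q l) ∧
        x = SplitSpin.cliffordProd Q l) ∧
    (∀ x : CliffordAlgebra Q, x ∈ SplitSpin.Spin₁ Q ↔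
      ∃ l : List V, (∀ v ∈ l, SplitSpin.IsUnitVector Q v) ∧
        Odd (SplitSpin.numPos Q l) ∧ Odd (SplitSpin.numNeg Q l) ∧
        x = SplitSpin.cliffordProd Q l) ∧
    ((1 : CliffordAlgebra Q) ∈ SplitSpin.Spin₀ Q ∧ (-1 : CliffordAlgebra Q) ∈ SplitSpin.Spin₀ Q) ∧
    (∀ E E' : Fin 3 → V, SplitSpin.IsWittBasis Q E E' →
      SplitSpin.pseudoscalar Q E E' ∈ SplitSpin.Spin₁ Q ∧
      -SplitSpin.pseudoscalar Q E E' ∈ SplitSpin.Spin₁ Q ∧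
      CliffordAlgebra.equivExterior Q (SplitSpin.pseudoscalar Q E E') ∈ ⋀[ℝ]^6 V ∧
      SplitSpin.pseudoscalar Q E E' * SplitSpin.pseudoscalar Q E E' = 1) := by
  have hp : 1 < 3 := by norm_num
  have h₀ := hQ.spin₀_eq hp hp
  have h₁ := hQ.spin₁_eq hp hp
  have hone : (1 : CliffordAlgebra Q) ∈ SplitSpin.Spin₀ Q := by
    rw [h₀]
    exact SplitSpin.one_mem_parityClass_even
  refine ⟨⟨hQ.components_eq hp hp, fun h => ?_⟩, fun x => by rw [h₀]; rfl,
    fun x => by rw [h₁]; rfl, ⟨hone, ?_⟩, fun E E' hE => ⟨?_, ?_, ?_, hE.pseudoscalar_mul_self⟩⟩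
  · exact (h ▸ hone : (1 : CliffordAlgebra Q) ∈ SplitSpin.Spin₁ Q).2 hone
  · obtain ⟨e, -, he, -⟩ := hQ.exists_orthogonal_pair (by norm_num) (by norm_num)
    rw [h₀]
    exact SplitSpin.neg_one_mem_parityClass_even he
  · rw [h₁]
    exact hE.pseudoscalar_mem
  · rw [h₁]
    exact SplitSpin.neg_mem_parityClass_odd hE.pseudoscalar_mem
  · rw [SplitSpin.pseudoscalar, LinearEquiv.apply_symm_apply]
    exact ExteriorAlgebra.ιMulti_range ℝ 6 ⟨_, rfl⟩
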